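/- Let $M$ be a smooth (Hausdorff, finite-dimensional) manifold with an almost complex structure $J$ (a smooth field of endomorphisms of the tangent spaces with $J^2=-\mathrm{id}$), and let $\nabla$ be a smooth torsion-free affine connection on $M$, for instance the Levi-Civita connection of a pseudo-Riemannian metric on $M$. Put $$R(X,Y)Z=\nabla_X\nabla_YZ-\nabla_Y\nabla_XZ-\nabla_{[X,Y]}Z,\qquad (\nabla_XJ)(Y)=\nabla_X(JY)-J\nabla_XY .$$ For a vector field $X$ on $M$ let $X^V$ and $X^H$ be its vertical lift and its horizontal lift with respect to $\nabla$, which are vector fields on the total space $TM$ of the tangent bundle; at $u\in T_pM$, $X^V$ is the velocity at $t=0$ of $t\mapsto u+tX_p$, and $X^H=dU(X_p)-(\nabla_{X_p}U)^V$ for any vector field $U$ with $U_p=u$. Define tensor fields $J_1,J_2,J_3$ of endomorphisms of the tangent spaces of $TM$ by $$J_1X^H=-(JX)^H,\quad J_1X^V=(JX)^V;\qquad J_2X^H=X^V,\quad J_2X^V=-X^H;\qquad J_3X^H=(JX)^V,\quad J_3X^V=(JX)^H .$$ For a field $A$ of endomorphisms of the tangent spaces of a manifold and vector fields $X,Y$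 on it, let $$N_A(X,Y)=[X,Y]+A[AX,Y]+A[X,AY]-[AX,AY],$$ and write $N=N_J$ on $M$ and $N_\alpha=N_{J_\alpha}$ on $TM$. Then for all smooth vector fields $X,Y$ on $M$ and at every $u\in TM$: $$\begin{aligned} N_1(X^H,Y^H)&=\bigl(N(X,Y)\bigr)^H+\bigl(R(JX,JY)u+JR(JX,Y)u+JR(X,JY)u-R(X,Y)u\bigr)^V,\\ N_1(X^H,Y^V)&=\bigl((\nabla_{JX}J)(Y)-(\nabla_XJ)(JY)\bigr)^V,\\ N_1(X^V,Y^H)&=\bigl((\nabla_YJ)(JX)-(\nabla_{JY}J)(X)\bigr)^V,\qquad N_1(X^V,Y^V)=0;\\[4pt] N_2(X^H,Y^H)&=-N_2(X^V,Y^V)=-\bigl(R(X,Y)u\bigr)^V,\\ N_2(X^H,Y^V)&=N_2(X^V,Y^H)=-\bigl(R(X,Y)u\bigr)^H;\\[4pt] N_3(X^H,Y^H)&=\bigl(J(\nabla_XJ)(Y)-J(\nabla_YJ)(X)\bigr)^H-\bigl(R(X,Y)u\bigr)^V,\\ N_3(X^H,Y^V)&=\bigl(J(\nabla_XJ)(Y)+(\nabla_{JY}J)(X)\bigr)^V-\bigl(JR(X,JY)u\bigr)^H,\\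 N_3(X^V,Y^H)&=-\bigl((\nabla_{JX}J)(Y)+J(\nabla_YJ)(X)\bigr)^V-\bigl(JR(JX,Y)u\bigr)^H,\\ N_3(X^V,Y^V)&=-\bigl((\nabla_{JX}J)(Y)-(\nabla_{JY}J)(X)\bigr)^H+\bigl(R(JX,JY)u\bigr)^V . \end{aligned}$$ -/

import Mathlib

open Bundle FiberBundle VectorField
open scoped Manifold ContDiff

noncomputable section

namespace TangentLift

variable {E : Type*} [NormedAddCommGroup E] [NormedSpace ℝ E]

/-- The Nijenhuis expression
`N(X, Y) = [X, Y] + A [A X, Y] + A [X, A Y] - [A X, A Y]` of a field `A` of endomorphisms of the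
tangent spaces of a manifold, applied to two vector fields. -/
def nijenhuis {H : Type*} [TopologicalSpace H] (I : ModelWithCorners ℝ E H)
    {M : Type*} [TopologicalSpace M] [ChartedSpace H M]
    (A : ∀ p : M, TangentSpace I p →L[ℝ] TangentSpace I p)
    (X Y : ∀ p : M, TangentSpace I p) (p : M) : TangentSpace I p :=
  mlieBracket I X Y p
    + A p (mlieBracket I (fun q => A q (X q)) Y p)
    + A p (mlieBracket I X (fun q => A q (Y q)) p)
    - mlieBracket I (fun q => A q (X q)) (fun q => A q (Y q)) p

variable {M : Type*} [TopologicalSpace M] [ChartedSpace E M] [IsManifold 𝓘(ℝ, E) ∞ M]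

/-- An almost complex structure: a smooth field `J` of endomorphisms of the tangent spaces with
`J ∘ J = -id`. -/
structure AlmostComplexStructure (E : Type*) [NormedAddCommGroup E] [NormedSpace ℝ E]
    (M : Type*) [TopologicalSpace M] [ChartedSpace E M] [IsManifold 𝓘(ℝ, E) ∞ M] where
  toFun : ∀ p : M, TangentSpace 𝓘(ℝ, E) p →L[ℝ] TangentSpace 𝓘(ℝ, E) p
  smooth : ContMDiff 𝓘(ℝ, E) (𝓘(ℝ, E).prod 𝓘(ℝ, E →L[ℝ] E)) ∞
    (fun p => TotalSpace.mk' (E →L[ℝ] E)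
      (E := fun p : M => TangentSpace 𝓘(ℝ, E) p →L[ℝ] TangentSpace 𝓘(ℝ, E) p) p (toFun p))
  sq_eq_neg : ∀ (p : M) (v : TangentSpace 𝓘(ℝ, E) p), toFun p (toFun p v) = -v

instance : CoeFun (AlmostComplexStructure E M)
    (fun _ => ∀ p : M, TangentSpace 𝓘(ℝ, E) p →L[ℝ] TangentSpace 𝓘(ℝ, E) p) := ⟨fun J => J.toFun⟩

/-- The vector field `J X`. -/
def AlmostComplexStructure.map (J : AlmostComplexStructure E M)
    (X : ∀ p : M, TangentSpace 𝓘(ℝ, E) p) : ∀ p : M, TangentSpace 𝓘(ℝ, E) p :=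
  fun p => J p (X p)

/-- `X` is a smooth vector field on `M`. -/
def IsSmoothField (X : ∀ p : M, TangentSpace 𝓘(ℝ, E) p) : Prop :=
  ContMDiff 𝓘(ℝ, E) 𝓘(ℝ, E).tangent ∞ (fun p => (⟨p, X p⟩ : TangentBundle 𝓘(ℝ, E) M))

variable (E M) in
/-- Affine connections on `M`. Mathlib writes `∇ Y p (X p)` for `(∇_X Y)(p)`. -/
abbrev AffineConnection :=
  CovariantDerivative 𝓘(ℝ, E) E (TangentSpace 𝓘(ℝ, E) : M → Type _)

/-- `(∇_X J) Y = ∇_X (J Y) - J (∇_X Y)`. -/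
def covDerivJ (D : AffineConnection E M) (J : AlmostComplexStructure E M)
    (X Y : ∀ p : M, TangentSpace 𝓘(ℝ, E) p) (p : M) : TangentSpace 𝓘(ℝ, E) p :=
  D (J.map Y) p (X p) - J p (D Y p (X p))

/-- `R(X, Y) Z = ∇_X ∇_Y Z - ∇_Y ∇_X Z - ∇_{[X, Y]} Z`. -/
def curvature (D : AffineConnection E M) (X Y Z : ∀ p : M, TangentSpace 𝓘(ℝ, E) p) (p : M) :
    TangentSpace 𝓘(ℝ, E) p :=
  D (fun q => D Z q (Y q)) p (X p) - D (fun q => D Z q (X q)) p (Y p)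
    - D Z p (mlieBracket 𝓘(ℝ, E) X Y p)

/-- `R(X, Y) u` for a tangent vector `u ∈ T_p M`: the value at `p` of `R(X, Y) U` where `U` is a
vector field, smooth near `p`, with `U p = u`. The curvature is tensorial, so the choice of `U`
does not matter. -/
def curvatureAt (D : AffineConnection E M) (X Y : ∀ p : M, TangentSpace 𝓘(ℝ, E) p)
    (u : TangentBundle 𝓘(ℝ, E) M) : TangentSpace 𝓘(ℝ, E) u.proj :=
  curvature D X Y (extend E u.2) u.proj

/-- The vertical lift `T_p M → T_u TM` at `u ∈ T_p M`: the derivative at `u` of the inclusion of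
the fibre `T_p M` (which as a vector space is `E`) into `TM`. -/
def vertical (u : TangentBundle 𝓘(ℝ, E) M) :
    TangentSpace 𝓘(ℝ, E) u.proj →L[ℝ] TangentSpace 𝓘(ℝ, E).tangent u :=
  mfderiv 𝓘(ℝ, E) 𝓘(ℝ, E).tangent
    (fun v : E => (⟨u.proj, v⟩ : TangentBundle 𝓘(ℝ, E) M)) u.2

/-- The derivative at `p` of the map `U : M → TM`, where `u ∈ T_p M` and `U = extend E u.2` is a
vector field, smooth near `p`, with `U p = u`. -/
def extendDeriv (u : TangentBundle 𝓘(ℝ, E) M) :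
    TangentSpace 𝓘(ℝ, E) u.proj →L[ℝ] TangentSpace 𝓘(ℝ, E).tangent u :=
  mfderiv 𝓘(ℝ, E) 𝓘(ℝ, E).tangent
    (fun q => (⟨q, extend E u.2 q⟩ : TangentBundle 𝓘(ℝ, E) M)) u.proj

/-- The horizontal lift `T_p M → T_u TM` at `u ∈ T_p M` with respect to the connection: it sends
`ξ` to `dU(ξ) - (∇_ξ U)^V`, where `U` is a vector field, smooth near `p`, with `U p = u`, seen as
a map `M → TM`. The choice of `U` does not matter. If `∇_ξ U = 0`, it is the velocity `dU(ξ)` of a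
vector field that is parallel in the direction `ξ`. -/
def horizontal (D : AffineConnection E M) (u : TangentBundle 𝓘(ℝ, E) M) :
    TangentSpace 𝓘(ℝ, E) u.proj →L[ℝ] TangentSpace 𝓘(ℝ, E).tangent u :=
  extendDeriv u - (vertical u).comp (D (extend E u.2) u.proj)

/-- The vertical lift `X^V` of a vector field. -/
def vLift (X : ∀ p : M, TangentSpace 𝓘(ℝ, E) p) (u : TangentBundle 𝓘(ℝ, E) M) :
    TangentSpace 𝓘(ℝ, E).tangent u :=
  vertical u (X u.proj)

/-- The horizontal lift `X^H` of a vector field. -/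
def hLift (D : AffineConnection E M) (X : ∀ p : M, TangentSpace 𝓘(ℝ, E) p)
    (u : TangentBundle 𝓘(ℝ, E) M) : TangentSpace 𝓘(ℝ, E).tangent u :=
  horizontal D u (X u.proj)

/-- `(ξ, η) ↦ ξ^H + η^V`. -/
def hvMap (D : AffineConnection E M) (u : TangentBundle 𝓘(ℝ, E) M) :
    (TangentSpace 𝓘(ℝ, E) u.proj × TangentSpace 𝓘(ℝ, E) u.proj) →L[ℝ]
      TangentSpace 𝓘(ℝ, E).tangent u :=
  (horizontal D u).coprod (vertical u)

/-- The trivialization of `TM` at `p`, restricted to the fibre over `p`, is linear. -/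
def trivL (p : M) : E →L[ℝ] E :=
  (trivializationAt E (TangentSpace 𝓘(ℝ, E) : M → Type _) p).continuousLinearMapAt ℝ p

lemma trivialization_fibre (p : M) (v : E) :
    trivializationAt E (TangentSpace 𝓘(ℝ, E)) p (⟨p, v⟩ : TangentBundle 𝓘(ℝ, E) M) =
      (p, trivL p v) := by
  have h := Trivialization.coe_linearMapAt_of_mem (R := ℝ)
    (trivializationAt E (TangentSpace 𝓘(ℝ, E) : M → Type _) p) (mem_baseSet_trivializationAt' p)
  exact Prod.ext rfl (congrFun h v).symm

lemma mdiff_fibre (p : M) (v : E) : MDifferentiableAt 𝓘(ℝ, E) 𝓘(ℝ, E).tangent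
    (fun v : E => (⟨p, v⟩ : TangentBundle 𝓘(ℝ, E) M)) v := by
  rw [mdifferentiableAt_totalSpace]
  refine ⟨mdifferentiableAt_const, ?_⟩
  simp only [trivialization_fibre]
  exact (trivL p).mdifferentiableAt

lemma mdiff_proj (u : TangentBundle 𝓘(ℝ, E) M) : MDifferentiableAt 𝓘(ℝ, E).tangent 𝓘(ℝ, E)
    (TotalSpace.proj : TangentBundle 𝓘(ℝ, E) M → M) u :=
  (contMDiff_proj (n := 1) (IB := 𝓘(ℝ, E)) (F := E)
    (TangentSpace 𝓘(ℝ, E) : M → Type _)).mdifferentiableAt one_ne_zero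

lemma proj_vertical_aux (p : M) (v η : E) :
    mfderiv 𝓘(ℝ, E).tangent 𝓘(ℝ, E) (TotalSpace.proj : TangentBundle 𝓘(ℝ, E) M → M) ⟨p, v⟩
      (mfderiv 𝓘(ℝ, E) 𝓘(ℝ, E).tangent
        (fun v : E => (⟨p, v⟩ : TangentBundle 𝓘(ℝ, E) M)) v η) = 0 := by
  have h := mfderiv_comp_apply (I := 𝓘(ℝ, E)) (I' := 𝓘(ℝ, E).tangent) (I'' := 𝓘(ℝ, E))
    (f := fun v : E => (⟨p, v⟩ : TangentBundle 𝓘(ℝ, E) M)) (x := v)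
    (mdiff_proj ⟨p, v⟩) (mdiff_fibre p v) η
  refine h.symm.trans ?_
  have hc : ((TotalSpace.proj : TangentBundle 𝓘(ℝ, E) M → M) ∘
      fun v : E => (⟨p, v⟩ : TangentBundle 𝓘(ℝ, E) M)) = fun _ => p := rfl
  rw [hc, mfderiv_const]
  rfl

lemma proj_vertical (u : TangentBundle 𝓘(ℝ, E) M) (η : TangentSpace 𝓘(ℝ, E) u.proj) :
    mfderiv 𝓘(ℝ, E).tangent 𝓘(ℝ, E) (TotalSpace.proj : TangentBundle 𝓘(ℝ, E) M → M) u
      (vertical u η) = 0 :=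
  by
  cases u with | mk p v => exact proj_vertical_aux (E := E) p v η

lemma proj_extendDeriv (u : TangentBundle 𝓘(ℝ, E) M) (ξ : TangentSpace 𝓘(ℝ, E) u.proj) :
    mfderiv 𝓘(ℝ, E).tangent 𝓘(ℝ, E) (TotalSpace.proj : TangentBundle 𝓘(ℝ, E) M → M) u
      (extendDeriv u ξ) = ξ := by
  have hu : (⟨u.proj, extend E u.2 u.proj⟩ : TangentBundle 𝓘(ℝ, E) M) = u := by
    rw [extend_apply_self]
  have h := mfderiv_comp_apply (I := 𝓘(ℝ, E)) (I' := 𝓘(ℝ, E).tangent) (I'' := 𝓘(ℝ, E))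
    (f := fun q => (⟨q, extend E u.2 q⟩ : TangentBundle 𝓘(ℝ, E) M)) (x := u.proj)
    (mdiff_proj _) (mdifferentiableAt_extend 𝓘(ℝ, E) E u.2) ξ
  have hc : ((TotalSpace.proj : TangentBundle 𝓘(ℝ, E) M → M) ∘
      fun q => (⟨q, extend E u.2 q⟩ : TangentBundle 𝓘(ℝ, E) M)) = id := rfl
  rw [hc, mfderiv_id] at h
  refine Eq.trans ?_ h.symm
  have key : ∀ (w : TangentBundle 𝓘(ℝ, E) M) (ζ : E × E), w = u →
      (mfderiv 𝓘(ℝ, E).tangent 𝓘(ℝ, E) (TotalSpace.proj : TangentBundle 𝓘(ℝ, E) M → M) u :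
        E × E → E) ζ =
      (mfderiv 𝓘(ℝ, E).tangent 𝓘(ℝ, E) (TotalSpace.proj : TangentBundle 𝓘(ℝ, E) M → M) w :
        E × E → E) ζ := by
    rintro w ζ rfl; rfl
  exact key _ _ hu

lemma proj_horizontal (D : AffineConnection E M) (u : TangentBundle 𝓘(ℝ, E) M)
    (ξ : TangentSpace 𝓘(ℝ, E) u.proj) :
    mfderiv 𝓘(ℝ, E).tangent 𝓘(ℝ, E) (TotalSpace.proj : TangentBundle 𝓘(ℝ, E) M → M) u
      (horizontal D u ξ) = ξ := by
  simp [horizontal, proj_vertical, proj_extendDeriv]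

lemma trivL_injective (p : M) : Function.Injective (trivL (E := E) p) := by
  intro v w h
  have hm : p ∈ (trivializationAt E (TangentSpace 𝓘(ℝ, E) : M → Type _) p).baseSet :=
    mem_baseSet_trivializationAt' p
  have h' := congrArg
    ((trivializationAt E (TangentSpace 𝓘(ℝ, E) : M → Type _) p).symmL ℝ p) h
  exact ((Trivialization.symmL_continuousLinearMapAt _ hm _).symm.trans h').trans
    (Trivialization.symmL_continuousLinearMapAt _ hm _)

/-- The fibre coordinate of the trivialization of `TM` at `p`. -/
def fibreCoord (p : M) (w : TangentBundle 𝓘(ℝ, E) M) : E :=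
  (trivializationAt E (TangentSpace 𝓘(ℝ, E) : M → Type _) p w).2

lemma mdiff_fibreCoord (p : M) (v : E) : MDifferentiableAt 𝓘(ℝ, E).tangent 𝓘(ℝ, E)
    (fibreCoord p) (⟨p, v⟩ : TangentBundle 𝓘(ℝ, E) M) := by
  have h : ContMDiffAt 𝓘(ℝ, E).tangent (𝓘(ℝ, E).prod 𝓘(ℝ, E)) 1
      (trivializationAt E (TangentSpace 𝓘(ℝ, E) : M → Type _) p)
      (⟨p, v⟩ : TangentBundle 𝓘(ℝ, E) M) :=
    (Trivialization.contMDiffOn (IB := 𝓘(ℝ, E)) (n := 1) _).contMDiffAt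
      ((trivializationAt E (TangentSpace 𝓘(ℝ, E) : M → Type _) p).open_source.mem_nhds
        ((Trivialization.mem_source _).2 (mem_baseSet_trivializationAt' p)))
  exact (h.snd).mdifferentiableAt one_ne_zero

lemma mfderiv_fibreCoord_fibre (p : M) (v η : E) :
    mfderiv 𝓘(ℝ, E).tangent 𝓘(ℝ, E) (fibreCoord p) (⟨p, v⟩ : TangentBundle 𝓘(ℝ, E) M)
      (mfderiv 𝓘(ℝ, E) 𝓘(ℝ, E).tangent
        (fun v : E => (⟨p, v⟩ : TangentBundle 𝓘(ℝ, E) M)) v η) = trivL p η := by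
  have h := mfderiv_comp_apply (I := 𝓘(ℝ, E)) (I' := 𝓘(ℝ, E).tangent) (I'' := 𝓘(ℝ, E))
    (f := fun v : E => (⟨p, v⟩ : TangentBundle 𝓘(ℝ, E) M)) (x := v)
    (mdiff_fibreCoord p v) (mdiff_fibre p v) η
  have hc : (fibreCoord p ∘ fun v : E => (⟨p, v⟩ : TangentBundle 𝓘(ℝ, E) M)) = trivL p := by
    funext v
    exact congrArg Prod.snd (trivialization_fibre p v)
  refine h.symm.trans ?_
  rw [hc, ContinuousLinearMap.mfderiv_eq]
  rfl

lemma vertical_injective (u : TangentBundle 𝓘(ℝ, E) M) : Function.Injective (vertical u) :=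
  (injective_iff_map_eq_zero _).2 fun η hη => by
    cases u with
    | mk p v =>
      have h := mfderiv_fibreCoord_fibre (E := E) p v η
      have h0 : trivL (E := E) p η = 0 := h.symm.trans
        ((congrArg (mfderiv 𝓘(ℝ, E).tangent 𝓘(ℝ, E) (fibreCoord p) ⟨p, v⟩) hη).trans
          (map_zero _))
      exact (injective_iff_map_eq_zero (trivL (E := E) p)).1 (trivL_injective p) η h0

lemma hvMap_injective (D : AffineConnection E M) (u : TangentBundle 𝓘(ℝ, E) M) :
    Function.Injective (hvMap D u) := by
  rw [injective_iff_map_eq_zero]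
  rintro ⟨ξ, η⟩ h
  have h' : horizontal D u ξ + vertical u η = 0 := h
  have h1 := congrArg
    (mfderiv 𝓘(ℝ, E).tangent 𝓘(ℝ, E) (TotalSpace.proj : TangentBundle 𝓘(ℝ, E) M → M) u) h'
  rw [map_add, proj_horizontal, proj_vertical, add_zero, map_zero] at h1
  rw [h1, map_zero, zero_add] at h'
  rw [h1, (injective_iff_map_eq_zero _).1 (vertical_injective u) η h']
  rfl

variable [FiniteDimensional ℝ E]

/-- The horizontal and the vertical subspaces are complementary:
`(ξ, η) ↦ ξ^H + η^V` is an isomorphism `T_p M × T_p M ≃ T_u TM`. -/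
def hvEquiv (D : AffineConnection E M) (u : TangentBundle 𝓘(ℝ, E) M) :
    (TangentSpace 𝓘(ℝ, E) u.proj × TangentSpace 𝓘(ℝ, E) u.proj) ≃L[ℝ]
      TangentSpace 𝓘(ℝ, E).tangent u :=
  haveI : FiniteDimensional ℝ (TangentSpace 𝓘(ℝ, E) u.proj) :=
    inferInstanceAs (FiniteDimensional ℝ E)
  haveI : FiniteDimensional ℝ (TangentSpace 𝓘(ℝ, E).tangent u) :=
    inferInstanceAs (FiniteDimensional ℝ (E × E))
  haveI : T2Space (TangentSpace 𝓘(ℝ, E) u.proj) := inferInstanceAs (T2Space E)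
  haveI : T2Space (TangentSpace 𝓘(ℝ, E).tangent u) := inferInstanceAs (T2Space (E × E))
  (LinearEquiv.ofInjectiveOfFinrankEq (hvMap D u).toLinearMap (hvMap_injective D u)
    rfl).toContinuousLinearEquiv

lemma hvEquiv_apply (D : AffineConnection E M) (u : TangentBundle 𝓘(ℝ, E) M)
    (ξ η : TangentSpace 𝓘(ℝ, E) u.proj) :
    hvEquiv D u (ξ, η) = horizontal D u ξ + vertical u η := rfl

/-- `J₁ : ξ^H + η^V ↦ -(J ξ)^H + (J η)^V`. -/
def J₁ (D : AffineConnection E M) (J : AlmostComplexStructure E M)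
    (u : TangentBundle 𝓘(ℝ, E) M) :
    TangentSpace 𝓘(ℝ, E).tangent u →L[ℝ] TangentSpace 𝓘(ℝ, E).tangent u :=
  (horizontal D u).comp ((-J u.proj).comp
      ((ContinuousLinearMap.fst ℝ _ _).comp (hvEquiv D u).symm.toContinuousLinearMap))
    + (vertical u).comp ((J u.proj).comp
      ((ContinuousLinearMap.snd ℝ _ _).comp (hvEquiv D u).symm.toContinuousLinearMap))

/-- `J₂ : ξ^H + η^V ↦ -η^H + ξ^V`. -/
def J₂ (D : AffineConnection E M) (u : TangentBundle 𝓘(ℝ, E) M) :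
    TangentSpace 𝓘(ℝ, E).tangent u →L[ℝ] TangentSpace 𝓘(ℝ, E).tangent u :=
  -(horizontal D u).comp
      ((ContinuousLinearMap.snd ℝ _ _).comp (hvEquiv D u).symm.toContinuousLinearMap)
    + (vertical u).comp
      ((ContinuousLinearMap.fst ℝ _ _).comp (hvEquiv D u).symm.toContinuousLinearMap)

/-- `J₃ : ξ^H + η^V ↦ (J η)^H + (J ξ)^V`. -/
def J₃ (D : AffineConnection E M) (J : AlmostComplexStructure E M)
    (u : TangentBundle 𝓘(ℝ, E) M) :
    TangentSpace 𝓘(ℝ, E).tangent u →L[ℝ] TangentSpace 𝓘(ℝ, E).tangent u :=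
  (horizontal D u).comp ((J u.proj).comp
      ((ContinuousLinearMap.snd ℝ _ _).comp (hvEquiv D u).symm.toContinuousLinearMap))
    + (vertical u).comp ((J u.proj).comp
      ((ContinuousLinearMap.fst ℝ _ _).comp (hvEquiv D u).symm.toContinuousLinearMap))

section Action

variable (D : AffineConnection E M) (J : AlmostComplexStructure E M)
  (X : ∀ p : M, TangentSpace 𝓘(ℝ, E) p) (u : TangentBundle 𝓘(ℝ, E) M)

lemma hvEquiv_symm_hLift : (hvEquiv D u).symm (hLift D X u) = (X u.proj, 0) := by
  rw [ContinuousLinearEquiv.symm_apply_eq, hvEquiv_apply, map_zero, add_zero, hLift]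

lemma hvEquiv_symm_vLift : (hvEquiv D u).symm (vLift X u) = (0, X u.proj) := by
  rw [ContinuousLinearEquiv.symm_apply_eq, hvEquiv_apply, map_zero, zero_add, vLift]

lemma J₁_hLift : J₁ D J u (hLift D X u) = -hLift D (J.map X) u := by
  simp [J₁, hvEquiv_symm_hLift]
  rfl

lemma J₁_vLift : J₁ D J u (vLift X u) = vLift (J.map X) u := by
  simp [J₁, hvEquiv_symm_vLift]
  rfl

lemma J₂_hLift : J₂ D u (hLift D X u) = vLift X u := by
  simp [J₂, hvEquiv_symm_hLift, vLift]

lemma J₂_vLift : J₂ D u (vLift X u) = -hLift D X u := by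
  simp [J₂, hvEquiv_symm_vLift, hLift]

lemma J₃_hLift : J₃ D J u (hLift D X u) = vLift (J.map X) u := by
  simp [J₃, hvEquiv_symm_hLift, vLift, AlmostComplexStructure.map]

lemma J₃_vLift : J₃ D J u (vLift X u) = hLift D (J.map X) u := by
  simp [J₃, hvEquiv_symm_vLift, hLift, AlmostComplexStructure.map]

end Action

/-- The connection has torsion zero: `∇_X Y - ∇_Y X = [X, Y]`. -/
def IsTorsionFree (D : AffineConnection E M) : Prop :=
  haveI : CompleteSpace E := FiniteDimensional.complete ℝ E
  haveI : IsManifold 𝓘(ℝ, E) 2 M := inferInstance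
  D.torsion = 0

end TangentLift

end

open Bundle FiberBundle VectorField
open scoped Manifold ContDiff Topology

noncomputable section

namespace TangentLift

section

/-! ### Lie brackets read in a chart -/

section Chart

variable {F H : Type*} [NormedAddCommGroup F] [NormedSpace ℝ F] [TopologicalSpace H]
  {N : Type*} [TopologicalSpace N] [ChartedSpace H N]

/-! Everything follows from three bracket formulas at `u`: `[X^V, Y^V] = 0`, `[X^H, Y^V] = (∇_X
Y)^V` and `[X^H, Y^H] = [X, Y]^H - (R(X, Y)u)^V`. Each `J_α` sends lifts to lifts up to sign, so
every term of `N_α` on lifts is a bracket of lifts, possibly followed by `J_α`. Substituting the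
three formulas, using `J² = -1` and replacing `[X, Y]` by `∇_X Y - ∇_Y X`, leaves an identity in an
abelian group. Vanishing torsion is what merges the base brackets in `N_2` and `N_3` with covariant
derivatives.

The bracket formulas (`mlieBracket_vLift_vLift`, `mlieBracket_hLift_vLift`,
`mlieBracket_hLift_hLift`) are proved in the chart of `TM` induced by a chart of `M`. With
Christoffel symbols `K(x, w)ξ`, linear in the fibre coordinate `w`, the lifts become `X^V = (0, X)`
and `X^H = (X, -K X)` on `E × E`, and their brackets are computed by ordinary differentiation. The
fibre derivative of `K` completes `∇_X Y` in the mixed bracket. In the horizontal bracket, the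
derivatives of `K` along the lifts give the curvature: `toCoord_curvatureAt` finds the same
expression by differentiating a field `U` with constant coordinates twice. Differentiability of `K`
comes from smoothness of the connection. -/

lemma mpullbackWithin_extChartAt_symm_of_mfderiv_eq {I : ModelWithCorners ℝ F H}
    [IsManifold I 1 N] {V : ∀ q : N, TangentSpace I q} {V' : F → F}
    {x : N} {z : F} (hz : z ∈ (extChartAt I x).target)
    (h : mfderiv I 𝓘(ℝ, F) (extChartAt I x) ((extChartAt I x).symm z)
      (V ((extChartAt I x).symm z)) = V' z) :
    mpullbackWithin 𝓘(ℝ, F) I (extChartAt I x).symm V (Set.range I) z = V' z := by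
  rw [mpullbackWithin_apply]
  refine (isInvertible_mfderivWithin_extChartAt_symm hz).inverse_apply_eq.2 ?_
  exact ((congrArg _ h.symm).trans (DFunLike.congr_fun
    (mfderivWithin_extChartAt_symm_comp_mfderiv_extChartAt hz)
    (V ((extChartAt I x).symm z)))).symm

/-- The Lie bracket of two vector fields, read in a chart, is the Lie bracket of their
coordinate expressions. -/
lemma mfderiv_extChartAt_mlieBracket {I : ModelWithCorners ℝ F H} [I.Boundaryless]
    [IsManifold I 1 N] {V W : ∀ q : N, TangentSpace I q} {V' W' : F → F} {x : N}
    (hV : ∀ᶠ w in 𝓝 x, mfderiv I 𝓘(ℝ, F) (extChartAt I x) w (V w) = V' (extChartAt I x w))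
    (hW : ∀ᶠ w in 𝓝 x, mfderiv I 𝓘(ℝ, F) (extChartAt I x) w (W w) = W' (extChartAt I x w)) :
    (mfderiv I 𝓘(ℝ, F) (extChartAt I x) x : F → F) (mlieBracket I V W x) =
      lieBracket ℝ V' W' (extChartAt I x x) := by
  -- The bracket depends only on germs, so it suffices that the pulled-back field and its coordinate
  -- expression agree near the image of `x`.
  have aux : ∀ {V : ∀ q : N, TangentSpace I q} {V' : F → F},
      (∀ᶠ w in 𝓝 x, mfderiv I 𝓘(ℝ, F) (extChartAt I x) w (V w) = V' (extChartAt I x w)) →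
      mpullbackWithin 𝓘(ℝ, F) I (extChartAt I x).symm V (Set.range I)
        =ᶠ[𝓝 (extChartAt I x x)] V' := by
    intro V V' hV
    have h0 : Filter.Tendsto (extChartAt I x).symm (𝓝 (extChartAt I x x)) (𝓝 x) := by
      have := continuousAt_extChartAt_symm (I := I) x
      rwa [ContinuousAt, extChartAt_to_inv] at this
    filter_upwards [h0.eventually hV, extChartAt_target_mem_nhds (I := I) x] with z hz hzt
    rw [(extChartAt I x).right_inv hzt] at hz
    exact mpullbackWithin_extChartAt_symm_of_mfderiv_eq hzt hz
  have hb : mlieBracket I V W x = (mfderiv I 𝓘(ℝ, F) (extChartAt I x) x).inverse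
      (lieBracket ℝ V' W' (extChartAt I x x) : F) := by
    rw [← mlieBracketWithin_univ, mlieBracketWithin_apply, Set.preimage_univ, I.range_eq_univ,
      Set.univ_inter]
    have h1 := aux hV
    have h2 := aux hW
    rw [I.range_eq_univ] at h1 h2
    exact congrArg _ ((congrFun lieBracketWithin_univ _).trans (h1.lieBracket_vectorField_eq h2))
  rw [hb]
  exact (isInvertible_mfderiv_extChartAt (mem_extChartAt_source x)).self_apply_inverse _

end Chart

/-! ### Coordinates of tangent vectors and vector fields -/

variable {E : Type*} [NormedAddCommGroup E] [NormedSpace ℝ E]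
  {M : Type*} [TopologicalSpace M] [ChartedSpace E M] [IsManifold 𝓘(ℝ, E) ∞ M]

/-- The coordinate vector at `p` of a tangent vector at `q`. -/
def toCoord (p q : M) : TangentSpace 𝓘(ℝ, E) q →L[ℝ] E :=
  (trivializationAt E (TangentSpace 𝓘(ℝ, E) : M → Type _) p).continuousLinearMapAt ℝ q

/-- The tangent vector at `q` with a given coordinate vector at `p`. -/
def ofCoord (p q : M) : E →L[ℝ] TangentSpace 𝓘(ℝ, E) q :=
  (trivializationAt E (TangentSpace 𝓘(ℝ, E) : M → Type _) p).symmL ℝ q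

variable {p q : M}

lemma toCoord_ofCoord (hq : q ∈ (chartAt E p).source) (v : E) :
    toCoord p q (ofCoord p q v) = v :=
  Trivialization.continuousLinearMapAt_symmL _ hq v

lemma ofCoord_toCoord (hq : q ∈ (chartAt E p).source) (v : TangentSpace 𝓘(ℝ, E) q) :
    ofCoord p q (toCoord p q v) = v :=
  Trivialization.symmL_continuousLinearMapAt _ hq v

lemma trivializationAt_mk (hq : q ∈ (chartAt E p).source) (v : TangentSpace 𝓘(ℝ, E) q) :
    trivializationAt E (TangentSpace 𝓘(ℝ, E)) p (⟨q, v⟩ : TangentBundle 𝓘(ℝ, E) M) =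
      (q, toCoord p q v) := by
  have h := Trivialization.coe_linearMapAt_of_mem (R := ℝ)
    (trivializationAt E (TangentSpace 𝓘(ℝ, E) : M → Type _) p) hq
  exact Prod.ext rfl (congrFun h v).symm

/-- The chart of `TM` at `(p, v)` does not depend on `v`: it pairs the chart at `p` with the fibre
coordinate. -/
lemma extChartAt_tangentBundle_mk {v : E} (hq : q ∈ (chartAt E p).source)
    (w : TangentSpace 𝓘(ℝ, E) q) :
    extChartAt 𝓘(ℝ, E).tangent (⟨p, v⟩ : TangentBundle 𝓘(ℝ, E) M)
      (⟨q, w⟩ : TangentBundle 𝓘(ℝ, E) M) = (extChartAt 𝓘(ℝ, E) p q, toCoord p q w) := by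
  rw [FiberBundle.extChartAt]
  exact Prod.ext rfl (congrArg (fun z : M × E => z.2) (trivializationAt_mk hq w))

lemma mfderiv_extChartAt_eq_toCoord (hq : q ∈ (chartAt E p).source) :
    mfderiv 𝓘(ℝ, E) 𝓘(ℝ, E) (extChartAt 𝓘(ℝ, E) p) q = toCoord p q :=
  (TangentBundle.continuousLinearMapAt_trivializationAt hq).symm

/-- The expression in coordinates at `p` of a vector field. -/
def coordField (p : M) (Z : ∀ q : M, TangentSpace 𝓘(ℝ, E) q) (x : E) : E :=
  toCoord p ((extChartAt 𝓘(ℝ, E) p).symm x) (Z ((extChartAt 𝓘(ℝ, E) p).symm x))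

lemma coordField_extChartAt (hq : q ∈ (chartAt E p).source)
    (Z : ∀ q : M, TangentSpace 𝓘(ℝ, E) q) :
    coordField p Z (extChartAt 𝓘(ℝ, E) p q) = toCoord p q (Z q) := by
  have h : (extChartAt 𝓘(ℝ, E) p).symm (extChartAt 𝓘(ℝ, E) p q) = q :=
    (extChartAt 𝓘(ℝ, E) p).left_inv (by rwa [extChartAt_source])
  rw [coordField, h]

lemma mdifferentiableAt_iff_coordField (hq : q ∈ (chartAt E p).source)
    {Z : ∀ q : M, TangentSpace 𝓘(ℝ, E) q} :
    MDifferentiableAt 𝓘(ℝ, E) 𝓘(ℝ, E).tangent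
      (fun q => (⟨q, Z q⟩ : TangentBundle 𝓘(ℝ, E) M)) q ↔
    DifferentiableAt ℝ (coordField p Z) (extChartAt 𝓘(ℝ, E) p q) := by
  have hs : q ∈ (extChartAt 𝓘(ℝ, E) p).source := by rwa [extChartAt_source]
  have hinv : (extChartAt 𝓘(ℝ, E) p).symm (extChartAt 𝓘(ℝ, E) p q) = q :=
    (extChartAt 𝓘(ℝ, E) p).left_inv hs
  have hnhds : (chartAt E p).source ∈ 𝓝 q := (chartAt E p).open_source.mem_nhds hq
  have hfib : (fun q => (trivializationAt E (TangentSpace 𝓘(ℝ, E)) p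
      (⟨q, Z q⟩ : TangentBundle 𝓘(ℝ, E) M)).2) =ᶠ[𝓝 q] fun q => toCoord p q (Z q) := by
    filter_upwards [hnhds] with q' hq'
    rw [trivializationAt_mk hq']
  refine ((trivializationAt E (TangentSpace 𝓘(ℝ, E) : M → Type _) p).mdifferentiableAt_section_iff
    _ Z hq).trans (hfib.mdifferentiableAt_iff.trans ⟨fun h => ?_, fun h => ?_⟩)
  · rw [← mdifferentiableAt_iff_differentiableAt]
    have h2 : MDifferentiableAt 𝓘(ℝ, E) 𝓘(ℝ, E) (extChartAt 𝓘(ℝ, E) p).symm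
        (extChartAt 𝓘(ℝ, E) p q) := by
      have := mdifferentiableWithinAt_extChartAt_symm ((extChartAt 𝓘(ℝ, E) p).map_source hs)
      rwa [ModelWithCorners.range_eq_univ, mdifferentiableWithinAt_univ] at this
    exact MDifferentiableAt.comp_of_eq (I := 𝓘(ℝ, E)) (I' := 𝓘(ℝ, E)) (I'' := 𝓘(ℝ, E))
      _ h h2 hinv
  · have h2 := MDifferentiableAt.comp (I := 𝓘(ℝ, E)) (I' := 𝓘(ℝ, E)) (I'' := 𝓘(ℝ, E)) q
      h.mdifferentiableAt (mdifferentiableAt_extChartAt hq)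
    refine h2.congr_of_eventuallyEq ?_
    filter_upwards [hnhds] with q' hq'
    exact (coordField_extChartAt hq' Z).symm

lemma hasMFDerivAt_toCoord (hq : q ∈ (chartAt E p).source)
    {Z : ∀ q : M, TangentSpace 𝓘(ℝ, E) q}
    (hZ : MDifferentiableAt 𝓘(ℝ, E) 𝓘(ℝ, E).tangent
      (fun q => (⟨q, Z q⟩ : TangentBundle 𝓘(ℝ, E) M)) q) :
    HasMFDerivAt 𝓘(ℝ, E) 𝓘(ℝ, E) (fun q => toCoord p q (Z q)) q
      ((fderiv ℝ (coordField p Z) (extChartAt 𝓘(ℝ, E) p q)).comp (toCoord p q)) := by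
  have h1 := ((mdifferentiableAt_iff_coordField hq).1 hZ).hasFDerivAt.hasMFDerivAt
  have h2 := (mdifferentiableAt_extChartAt (I := 𝓘(ℝ, E)) hq).hasMFDerivAt
  rw [mfderiv_extChartAt_eq_toCoord hq] at h2
  refine (HasMFDerivAt.comp q h1 h2).congr_of_eventuallyEq ?_
  filter_upwards [(chartAt E p).open_source.mem_nhds hq] with q' hq'
  exact (coordField_extChartAt hq' Z).symm

end

/-! ### Christoffel symbols -/

section

variable {E : Type*} [NormedAddCommGroup E] [NormedSpace ℝ E]
  {M : Type*} [TopologicalSpace M] [ChartedSpace E M] [IsManifold 𝓘(ℝ, E) ∞ M]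

lemma contMDiffOn_ofCoord (p : M) (v : E) :
    ContMDiffOn 𝓘(ℝ, E) 𝓘(ℝ, E).tangent ∞
      (fun q => (⟨q, ofCoord p q v⟩ : TangentBundle 𝓘(ℝ, E) M)) (chartAt E p).source := by
  refine ((trivializationAt E (TangentSpace 𝓘(ℝ, E) : M → Type _) p).contMDiffOn_section_baseSet_iff
    (s := fun q => ofCoord p q v)).2 ?_
  refine (contMDiffOn_const (c := v)).congr fun q hq => ?_
  exact (congrArg (fun z : M × E => z.2) (trivializationAt_mk hq (ofCoord p q v))).trans
    (toCoord_ofCoord hq v)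

lemma mdifferentiableAt_ofCoord {p q : M} (hq : q ∈ (chartAt E p).source) (v : E) :
    MDifferentiableAt 𝓘(ℝ, E) 𝓘(ℝ, E).tangent
      (fun q => (⟨q, ofCoord p q v⟩ : TangentBundle 𝓘(ℝ, E) M)) q :=
  ((contMDiffOn_ofCoord p v).contMDiffAt
    ((chartAt E p).open_source.mem_nhds hq)).mdifferentiableAt (by simp)

/-- The extension used to define curvature has constant coordinates on the whole chart domain, so
its covariant derivative is a pure Christoffel term there. -/
lemma extend_eq_ofCoord (p : M) (v : TangentSpace 𝓘(ℝ, E) p) {q : M}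
    (hq : q ∈ (chartAt E p).source) : extend E v q = ofCoord p q (toCoord p p v) := by
  have h := congrArg (fun z : M × E => z.2) (trivializationAt_mk (mem_chart_source E p) v)
  refine (congrArg (fun w : E => (trivializationAt E (TangentSpace 𝓘(ℝ, E) : M → Type _) p).symm
    q w) h).trans ?_
  exact (Trivialization.symmL_apply (R := ℝ) _ hq _).symm

lemma covariantDerivative_sum (D : AffineConnection E M) {ι : Type*} (s : Finset ι)
    (σ : ι → ∀ q : M, TangentSpace 𝓘(ℝ, E) q) (q : M)
    (hσ : ∀ i ∈ s, MDifferentiableAt 𝓘(ℝ, E) 𝓘(ℝ, E).tangent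
      (fun q => (⟨q, σ i q⟩ : TangentBundle 𝓘(ℝ, E) M)) q) :
    D (fun q => ∑ i ∈ s, σ i q) q = ∑ i ∈ s, D (σ i) q := by
  classical
  induction s using Finset.induction_on with
  | empty =>
    simp only [Finset.sum_empty]
    exact D.isCovariantDerivativeOnUniv.zero
  | insert a s ha ih =>
    simp only [Finset.sum_insert ha]
    have hs := fun i hi => hσ i (Finset.mem_insert_of_mem hi)
    rw [← ih hs]
    exact D.isCovariantDerivativeOnUniv.add (hσ a (Finset.mem_insert_self _ _))
      (.sum_section hs)

variable [FiniteDimensional ℝ E]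

/-- The Christoffel symbols at `q` of a connection, in coordinates at `p`: the endomorphism
`ξ ↦ ∇_ξ V`, where `V` has constant coordinates `v`. -/
def christoffel (D : AffineConnection E M) (p q : M) (v : E) : E →L[ℝ] E :=
  ∑ i, (Module.finBasis ℝ E).coord i v • ((toCoord p q).comp
      ((D (fun q => ofCoord p q (Module.finBasis ℝ E i)) q).comp (ofCoord p q)))

/-- Expanding `v` in a basis builds linearity into the definition, so it holds at every `q`, even
outside the chart domain, where the local frame carries no information. -/
lemma christoffel_add_smul (D : AffineConnection E M) (p q : M) (v w : E) (t : ℝ) :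
    christoffel D p q (v + t • w) = christoffel D p q v + t • christoffel D p q w := by
  simp only [christoffel, map_add, map_smul, smul_eq_mul, add_smul, mul_smul,
    Finset.sum_add_distrib, Finset.smul_sum]

/-- Write `Z` as a combination of the frame with constant coordinates and apply the Leibniz rule:
differentiating the coefficients gives the derivative term, differentiating the frame gives the
Christoffel term. -/
lemma toCoord_covariantDerivative (D : AffineConnection E M) {p q : M}
    (hq : q ∈ (chartAt E p).source) {Z : ∀ q : M, TangentSpace 𝓘(ℝ, E) q}
    (hZ : MDifferentiableAt 𝓘(ℝ, E) 𝓘(ℝ, E).tangent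
      (fun q => (⟨q, Z q⟩ : TangentBundle 𝓘(ℝ, E) M)) q) (ξ : TangentSpace 𝓘(ℝ, E) q) :
    toCoord p q (D Z q ξ) =
      fderiv ℝ (coordField p Z) (extChartAt 𝓘(ℝ, E) p q) (toCoord p q ξ)
        + christoffel D p q (toCoord p q (Z q)) (toCoord p q ξ) := by
  set b := Module.finBasis ℝ E with hb
  set c : Fin (Module.finrank ℝ E) → E →L[ℝ] ℝ :=
    fun i => LinearMap.toContinuousLinearMap (b.coord i) with hc
  set f : Fin (Module.finrank ℝ E) → M → ℝ := fun i q => c i (toCoord p q (Z q)) with hf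
  set e : Fin (Module.finrank ℝ E) → ∀ q : M, TangentSpace 𝓘(ℝ, E) q :=
    fun i q => ofCoord p q (b i) with he
  have hfd : ∀ i, HasMFDerivAt 𝓘(ℝ, E) 𝓘(ℝ, ℝ) (f i) q
      ((c i).comp ((fderiv ℝ (coordField p Z) (extChartAt 𝓘(ℝ, E) p q)).comp (toCoord p q))) :=
    fun i => HasMFDerivAt.comp (I := 𝓘(ℝ, E)) (I' := 𝓘(ℝ, E)) (I'' := 𝓘(ℝ, ℝ)) q
      (c i).hasMFDerivAt (hasMFDerivAt_toCoord hq hZ)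
  have hed : ∀ i, MDifferentiableAt 𝓘(ℝ, E) 𝓘(ℝ, E).tangent
      (fun q => (⟨q, e i q⟩ : TangentBundle 𝓘(ℝ, E) M)) q :=
    fun i => mdifferentiableAt_ofCoord hq (b i)
  have hfe : ∀ i, MDifferentiableAt 𝓘(ℝ, E) 𝓘(ℝ, E).tangent
      (fun q => (⟨q, (f i • e i) q⟩ : TangentBundle 𝓘(ℝ, E) M)) q :=
    fun i => (hfd i).mdifferentiableAt.smul_section (hed i)
  -- The expansion is valid only on the chart domain; locality of the connection makes this enough.
  have hsum : ∀ᶠ q' in 𝓝 q, Z q' = ∑ i, (f i • e i) q' := by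
    filter_upwards [(chartAt E p).open_source.mem_nhds hq] with q' hq'
    have h1 : toCoord p q' (Z q') = ∑ i, f i q' • b i :=
      (b.sum_repr (toCoord p q' (Z q'))).symm
    rw [← ofCoord_toCoord hq' (Z q'), h1, map_sum]
    simp [he]
  have hD : D Z q = ∑ i, D (f i • e i) q := by
    rw [← covariantDerivative_sum D _ _ _ fun i _ => hfe i]
    exact D.isCovariantDerivativeOnUniv.congr_of_eventuallyEq hZ
      (.sum_section fun i _ => hfe i) Filter.univ_mem hsum
  have hterm : ∀ i, toCoord p q (D (f i • e i) q ξ) =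
      c i (toCoord p q (Z q)) • toCoord p q (D (e i) q ξ) +
      c i (fderiv ℝ (coordField p Z) (extChartAt 𝓘(ℝ, E) p q) (toCoord p q ξ)) • b i := by
    intro i
    have h1 := D.isCovariantDerivativeOnUniv.leibniz (hed i) (hfd i).mdifferentiableAt
    have h2 : D (f i • e i) q ξ = f i q • D (e i) q ξ +
      (c i (fderiv ℝ (coordField p Z) (extChartAt 𝓘(ℝ, E) p q) (toCoord p q ξ))) • e i q := by
      refine (DFunLike.congr_fun h1 ξ).trans ?_
      exact congrArg (fun t : ℝ => f i q • D (e i) q ξ + t • e i q)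
        (DFunLike.congr_fun (hfd i).mfderiv ξ)
    rw [h2, map_add, map_smul, map_smul, he]
    simp only [toCoord_ofCoord hq]
    rfl
  have hχ : christoffel D p q (toCoord p q (Z q)) (toCoord p q ξ) =
      ∑ i, c i (toCoord p q (Z q)) • toCoord p q (D (e i) q ξ) := by
    simp only [christoffel, _root_.sum_apply,
      _root_.smul_apply, ContinuousLinearMap.comp_apply, ofCoord_toCoord hq]
    rfl
  rw [hD, hχ]
  have h5 : toCoord p q ((∑ i, D (f i • e i) q) ξ) = ∑ i, toCoord p q (D (f i • e i) q ξ) := by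
    rw [_root_.sum_apply, map_sum]
  rw [h5, Finset.sum_congr rfl fun i _ => hterm i, Finset.sum_add_distrib, add_comm]
  congr 1
  exact b.sum_repr _

end

/-! ### The lifts in the chart of `TM` -/

section

variable {E : Type*} [NormedAddCommGroup E] [NormedSpace ℝ E]
  {M : Type*} [TopologicalSpace M] [ChartedSpace E M] [IsManifold 𝓘(ℝ, E) ∞ M]

lemma mdifferentiableAt_extChartAt_tangentBundle {p q : M} (hq : q ∈ (chartAt E p).source)
    (v w : E) : MDifferentiableAt 𝓘(ℝ, E).tangent 𝓘(ℝ, E × E)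
      (extChartAt 𝓘(ℝ, E).tangent (⟨p, v⟩ : TangentBundle 𝓘(ℝ, E) M))
      (⟨q, w⟩ : TangentBundle 𝓘(ℝ, E) M) :=
  mdifferentiableAt_extChartAt ((TangentBundle.mem_chart_source_iff _ _).2 hq)

lemma mfderiv_extChartAt_vertical {p q : M} (hq : q ∈ (chartAt E p).source) (v w η : E) :
    (mfderiv 𝓘(ℝ, E).tangent 𝓘(ℝ, E × E)
      (extChartAt 𝓘(ℝ, E).tangent (⟨p, v⟩ : TangentBundle 𝓘(ℝ, E) M))
      (⟨q, w⟩ : TangentBundle 𝓘(ℝ, E) M) : E × E → E × E)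
      (vertical (⟨q, w⟩ : TangentBundle 𝓘(ℝ, E) M) η) = (0, toCoord p q η) := by
  have h := mfderiv_comp_apply (I := 𝓘(ℝ, E)) (I' := 𝓘(ℝ, E).tangent) (I'' := 𝓘(ℝ, E × E))
    (f := fun v : E => (⟨q, v⟩ : TangentBundle 𝓘(ℝ, E) M)) (x := w)
    (mdifferentiableAt_extChartAt_tangentBundle hq v w) (mdiff_fibre q w) η
  have hc : (extChartAt 𝓘(ℝ, E).tangent (⟨p, v⟩ : TangentBundle 𝓘(ℝ, E) M) ∘
      fun v : E => (⟨q, v⟩ : TangentBundle 𝓘(ℝ, E) M)) =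
      fun v : E => (extChartAt 𝓘(ℝ, E) p q, (toCoord p q : E →L[ℝ] E) v) := by
    funext z
    exact extChartAt_tangentBundle_mk hq z
  rw [hc] at h
  refine h.symm.trans ?_
  have h2 : HasFDerivAt (fun v : E => (extChartAt 𝓘(ℝ, E) p q, (toCoord p q : E →L[ℝ] E) v))
      ((0 : E →L[ℝ] E).prod (toCoord p q : E →L[ℝ] E)) w :=
    (hasFDerivAt_const _ _).prodMk (toCoord p q : E →L[ℝ] E).hasFDerivAt
  exact DFunLike.congr_fun h2.hasMFDerivAt.mfderiv η

/-- The extension is constant in coordinates centred at `q`, not at `p`, so the derivative term need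
not vanish. It cancels in the horizontal lift. -/
lemma mfderiv_extChartAt_extendDeriv {p q : M} (hq : q ∈ (chartAt E p).source) (v w ξ : E) :
    (mfderiv 𝓘(ℝ, E).tangent 𝓘(ℝ, E × E)
      (extChartAt 𝓘(ℝ, E).tangent (⟨p, v⟩ : TangentBundle 𝓘(ℝ, E) M))
      (⟨q, w⟩ : TangentBundle 𝓘(ℝ, E) M) : E × E → E × E)
      (extendDeriv (⟨q, w⟩ : TangentBundle 𝓘(ℝ, E) M) ξ) =
      (toCoord p q ξ, fderiv ℝ (coordField p (extend E (⟨q, w⟩ : TangentBundle 𝓘(ℝ, E) M).2))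
        (extChartAt 𝓘(ℝ, E) p q) (toCoord p q ξ)) := by
  set U : ∀ q' : M, TangentSpace 𝓘(ℝ, E) q' :=
    extend E (⟨q, w⟩ : TangentBundle 𝓘(ℝ, E) M).2 with hU
  have hUd : MDifferentiableAt 𝓘(ℝ, E) 𝓘(ℝ, E).tangent
      (fun q => (⟨q, U q⟩ : TangentBundle 𝓘(ℝ, E) M)) q :=
    mdifferentiableAt_extend 𝓘(ℝ, E) E (⟨q, w⟩ : TangentBundle 𝓘(ℝ, E) M).2
  have hUq : U q = w := extend_apply_self _ _
  have h := mfderiv_comp_apply (I := 𝓘(ℝ, E)) (I' := 𝓘(ℝ, E).tangent) (I'' := 𝓘(ℝ, E × E))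
    (f := fun q => (⟨q, U q⟩ : TangentBundle 𝓘(ℝ, E) M)) (x := q)
    (mdifferentiableAt_extChartAt_tangentBundle hq v (U q)) hUd ξ
  have h1 := (hasMFDerivAt_toCoord hq hUd)
  have h2 : HasMFDerivAt 𝓘(ℝ, E) 𝓘(ℝ, E × E)
      (extChartAt 𝓘(ℝ, E).tangent (⟨p, v⟩ : TangentBundle 𝓘(ℝ, E) M) ∘
        fun q => (⟨q, U q⟩ : TangentBundle 𝓘(ℝ, E) M)) q
      ((toCoord p q).prod
        ((fderiv ℝ (coordField p U) (extChartAt 𝓘(ℝ, E) p q)).comp (toCoord p q))) := by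
    have h3 := (mdifferentiableAt_extChartAt (I := 𝓘(ℝ, E)) hq).hasMFDerivAt
    rw [mfderiv_extChartAt_eq_toCoord hq] at h3
    have h5 : HasMFDerivAt 𝓘(ℝ, E) 𝓘(ℝ, E × E)
        (fun q => (extChartAt 𝓘(ℝ, E) p q, toCoord p q (U q))) q
        ((toCoord p q).prod
          ((fderiv ℝ (coordField p U) (extChartAt 𝓘(ℝ, E) p q)).comp (toCoord p q))) :=
      ⟨h3.1.prodMk h1.1, h3.2.prodMk h1.2⟩
    refine h5.congr_of_eventuallyEq ?_
    filter_upwards [(chartAt E p).open_source.mem_nhds hq] with q' hq'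
    exact extChartAt_tangentBundle_mk hq' (U q')
  have h4 := h.symm.trans (DFunLike.congr_fun h2.mfderiv ξ)
  rw [hUq] at h4
  exact h4

variable [FiniteDimensional ℝ E]

/-- The derivative of `U` occurs both in `dU(ξ)` and in `∇_ξ U`; subtracting leaves only the
Christoffel term, which sees `U` through its value `w`. The point `(q, w)` varies over the chart
because brackets need the lifts on a neighbourhood. -/
lemma mfderiv_extChartAt_horizontal (D : AffineConnection E M) {p q : M}
    (hq : q ∈ (chartAt E p).source) (v w ξ : E) :
    (mfderiv 𝓘(ℝ, E).tangent 𝓘(ℝ, E × E)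
      (extChartAt 𝓘(ℝ, E).tangent (⟨p, v⟩ : TangentBundle 𝓘(ℝ, E) M))
      (⟨q, w⟩ : TangentBundle 𝓘(ℝ, E) M) : E × E → E × E)
      (horizontal D (⟨q, w⟩ : TangentBundle 𝓘(ℝ, E) M) ξ) =
      (toCoord p q ξ, -christoffel D p q (toCoord p q w) (toCoord p q ξ)) := by
  set U : ∀ q' : M, TangentSpace 𝓘(ℝ, E) q' :=
    extend E (⟨q, w⟩ : TangentBundle 𝓘(ℝ, E) M).2 with hU
  have hUd : MDifferentiableAt 𝓘(ℝ, E) 𝓘(ℝ, E).tangent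
      (fun q => (⟨q, U q⟩ : TangentBundle 𝓘(ℝ, E) M)) q :=
    mdifferentiableAt_extend 𝓘(ℝ, E) E (⟨q, w⟩ : TangentBundle 𝓘(ℝ, E) M).2
  have hUq : U q = w := extend_apply_self _ _
  have h1 := mfderiv_extChartAt_extendDeriv hq v w ξ
  have h2 := mfderiv_extChartAt_vertical hq v w (D U q ξ)
  have h3 := toCoord_covariantDerivative D hq hUd ξ
  rw [hUq] at h3
  refine (map_sub (mfderiv 𝓘(ℝ, E).tangent 𝓘(ℝ, E × E)
      (extChartAt 𝓘(ℝ, E).tangent (⟨p, v⟩ : TangentBundle 𝓘(ℝ, E) M))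
      (⟨q, w⟩ : TangentBundle 𝓘(ℝ, E) M))
      (extendDeriv (⟨q, w⟩ : TangentBundle 𝓘(ℝ, E) M) ξ)
      (vertical (⟨q, w⟩ : TangentBundle 𝓘(ℝ, E) M) (D U q ξ))).trans ?_
  refine (congrArg₂ (fun a b : E × E => a - b) h1 h2).trans ?_
  rw [h3]
  ext <;> simp [hU]

end

section

/-! ### Brackets of lifts on the model space -/

section ModelSpace

variable {E : Type*} [NormedAddCommGroup E] [NormedSpace ℝ E]

/-- The coordinate expression of the vertical lift of a vector field. -/
def modelVLift (X : E → E) (z : E × E) : E × E := (0, X z.1)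

/-- The coordinate expression of the horizontal lift of a vector field, for a connection with
Christoffel symbols `K`. -/
def modelHLift (K : E × E → E →L[ℝ] E) (X : E → E) (z : E × E) : E × E :=
  (X z.1, -K z (X z.1))

/-- The coordinate expression of the curvature. -/
def modelCurvature (K : E × E → E →L[ℝ] E) (X Y : E → E) (z : E × E) : E :=
  fderiv ℝ K z (modelHLift K X z) (Y z.1) - fderiv ℝ K z (modelHLift K Y z) (X z.1)

variable {K : E × E → E →L[ℝ] E} {X Y : E → E} {z : E × E}

lemma hasFDerivAt_comp_fst (hX : DifferentiableAt ℝ X z.1) :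
    HasFDerivAt (fun z : E × E => X z.1)
      ((fderiv ℝ X z.1).comp (ContinuousLinearMap.fst ℝ E E)) z :=
  HasFDerivAt.comp z hX.hasFDerivAt hasFDerivAt_fst

lemma fderiv_modelVLift (hX : DifferentiableAt ℝ X z.1) (a : E × E) :
    fderiv ℝ (modelVLift X) z a = (0, fderiv ℝ X z.1 a.1) := by
  have h : HasFDerivAt (modelVLift X) _ z :=
    (hasFDerivAt_const (0 : E) z).prodMk (hasFDerivAt_comp_fst hX)
  rw [h.fderiv]
  rfl

lemma fderiv_modelHLift (hK : DifferentiableAt ℝ K z) (hX : DifferentiableAt ℝ X z.1)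
    (a : E × E) : fderiv ℝ (modelHLift K X) z a =
      (fderiv ℝ X z.1 a.1, -(K z (fderiv ℝ X z.1 a.1) + fderiv ℝ K z a (X z.1))) := by
  have h1 := hasFDerivAt_comp_fst hX
  have h : HasFDerivAt (modelHLift K X) _ z := h1.prodMk (hK.hasFDerivAt.clm_apply h1).neg
  rw [h.fderiv]
  rfl

lemma lieBracket_modelVLift_modelVLift (hX : DifferentiableAt ℝ X z.1)
    (hY : DifferentiableAt ℝ Y z.1) :
    lieBracket ℝ (modelVLift X) (modelVLift Y) z = 0 := by
  rw [lieBracket, fderiv_modelVLift hX, fderiv_modelVLift hY]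
  simp [modelVLift]

/-- A vertical lift has no base component, so `K` is differentiated along the fibre only. -/
lemma lieBracket_modelHLift_modelVLift (hK : DifferentiableAt ℝ K z)
    (hX : DifferentiableAt ℝ X z.1) (hY : DifferentiableAt ℝ Y z.1) :
    lieBracket ℝ (modelHLift K X) (modelVLift Y) z =
      (0, fderiv ℝ Y z.1 (X z.1) + fderiv ℝ K z (0, Y z.1) (X z.1)) := by
  rw [lieBracket, fderiv_modelVLift hY, fderiv_modelHLift hK hX]
  simp [modelHLift, modelVLift]

/-- The derivatives of `X` and `Y` assemble into their bracket and its horizontal correction; what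
remains is the antisymmetrized derivative of `K` along the lifts. -/
lemma lieBracket_modelHLift_modelHLift (hK : DifferentiableAt ℝ K z)
    (hX : DifferentiableAt ℝ X z.1) (hY : DifferentiableAt ℝ Y z.1) :
    lieBracket ℝ (modelHLift K X) (modelHLift K Y) z =
      (lieBracket ℝ X Y z.1, -K z (lieBracket ℝ X Y z.1) - modelCurvature K X Y z) := by
  rw [lieBracket, fderiv_modelHLift hK hX, fderiv_modelHLift hK hY, modelCurvature, lieBracket]
  refine Prod.ext rfl ?_
  simp only [modelHLift, Prod.snd_sub, map_sub]
  abel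

/-- Along the fibre `K` is affine, so its line derivative is its own slope. -/
lemma fderiv_apply_vertical (hK : DifferentiableAt ℝ K z)
    (hlin : ∀ (w : E) (t : ℝ), K (z.1, z.2 + t • w) = K z + t • K (z.1, w)) (w : E) :
    fderiv ℝ K z (0, w) = K (z.1, w) := by
  have h1 := (hK.hasFDerivAt.hasLineDerivAt (0, w))
  have h2 : HasLineDerivAt ℝ K (K (z.1, w)) z (0, w) := by
    have h3 : HasDerivAt (fun t : ℝ => K z + t • K (z.1, w)) (K (z.1, w)) 0 := by
      simpa using ((hasDerivAt_id (0 : ℝ)).smul_const (K (z.1, w))).const_add (K z)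
    refine h3.congr_of_eventuallyEq (Filter.Eventually.of_forall fun t => ?_)
    have hz : z + t • ((0, w) : E × E) = (z.1, z.2 + t • w) := by ext <;> simp
    exact (congrArg K hz).trans (hlin w t)
  exact h1.unique h2

end ModelSpace

variable {E : Type*} [NormedAddCommGroup E] [NormedSpace ℝ E]
  {M : Type*} [TopologicalSpace M] [ChartedSpace E M] [IsManifold 𝓘(ℝ, E) ∞ M]

lemma eventually_mem_chart_source (u : TangentBundle 𝓘(ℝ, E) M) :
    ∀ᶠ w in 𝓝 u, w.proj ∈ (chartAt E u.proj).source :=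
  (FiberBundle.continuous_proj E (TangentSpace 𝓘(ℝ, E) : M → Type _)).continuousAt.eventually
    ((chartAt E u.proj).open_source.mem_nhds (mem_chart_source E u.proj))

lemma mfderiv_extChartAt_vLift (X : ∀ p : M, TangentSpace 𝓘(ℝ, E) p)
    (u : TangentBundle 𝓘(ℝ, E) M) :
    ∀ᶠ w in 𝓝 u, (mfderiv 𝓘(ℝ, E).tangent 𝓘(ℝ, E × E) (extChartAt 𝓘(ℝ, E).tangent u) w :
      E × E → E × E) (vLift X w) =
      modelVLift (coordField u.proj X) (extChartAt 𝓘(ℝ, E).tangent u w) := by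
  rcases u with ⟨p, v⟩
  filter_upwards [eventually_mem_chart_source (⟨p, v⟩ : TangentBundle 𝓘(ℝ, E) M)] with w hw
  rcases w with ⟨q, w⟩
  refine (mfderiv_extChartAt_vertical hw v w (X q)).trans ?_
  refine Eq.trans ?_ (congrArg _ (extChartAt_tangentBundle_mk hw w)).symm
  rw [modelVLift, coordField_extChartAt hw]

variable [FiniteDimensional ℝ E]

/-- The Christoffel symbols of a connection in coordinates at `p`, as a function on the model
space. -/
def coordChristoffel (D : AffineConnection E M) (p : M) (z : E × E) : E →L[ℝ] E :=
  christoffel D p ((extChartAt 𝓘(ℝ, E) p).symm z.1) z.2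

lemma coordChristoffel_extChartAt (D : AffineConnection E M) {p q : M}
    (hq : q ∈ (chartAt E p).source) (v : E) :
    coordChristoffel D p (extChartAt 𝓘(ℝ, E) p q, v) = christoffel D p q v := by
  have h : (extChartAt 𝓘(ℝ, E) p).symm (extChartAt 𝓘(ℝ, E) p q) = q :=
    (extChartAt 𝓘(ℝ, E) p).left_inv (by rwa [extChartAt_source])
  rw [coordChristoffel, h]

lemma mfderiv_extChartAt_hLift (D : AffineConnection E M) (X : ∀ p : M, TangentSpace 𝓘(ℝ, E) p)
    (u : TangentBundle 𝓘(ℝ, E) M) :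
    ∀ᶠ w in 𝓝 u, (mfderiv 𝓘(ℝ, E).tangent 𝓘(ℝ, E × E) (extChartAt 𝓘(ℝ, E).tangent u) w :
      E × E → E × E) (hLift D X w) =
      modelHLift (coordChristoffel D u.proj) (coordField u.proj X)
        (extChartAt 𝓘(ℝ, E).tangent u w) := by
  rcases u with ⟨p, v⟩
  filter_upwards [eventually_mem_chart_source (⟨p, v⟩ : TangentBundle 𝓘(ℝ, E) M)] with w hw
  rcases w with ⟨q, w⟩
  refine (mfderiv_extChartAt_horizontal D hw v w (X q)).trans ?_
  refine Eq.trans ?_ (congrArg _ (extChartAt_tangentBundle_mk hw w)).symm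
  rw [modelHLift, coordField_extChartAt hw, coordChristoffel_extChartAt D hw]

end

/-! ### Regularity of the Christoffel symbols, and curvature in coordinates -/

section

variable {E : Type*} [NormedAddCommGroup E] [NormedSpace ℝ E]
  {M : Type*} [TopologicalSpace M] [ChartedSpace E M] [IsManifold 𝓘(ℝ, E) ∞ M]

lemma IsSmoothField.mdifferentiableAt {X : ∀ p : M, TangentSpace 𝓘(ℝ, E) p}
    (hX : IsSmoothField X) (p : M) : MDifferentiableAt 𝓘(ℝ, E) 𝓘(ℝ, E).tangent
      (fun q => (⟨q, X q⟩ : TangentBundle 𝓘(ℝ, E) M)) p :=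
  ContMDiffAt.mdifferentiableAt (hX p) (by simp)

lemma IsSmoothField.differentiableAt_coordField {X : ∀ p : M, TangentSpace 𝓘(ℝ, E) p}
    (hX : IsSmoothField X) (p : M) :
    DifferentiableAt ℝ (coordField p X) (extChartAt 𝓘(ℝ, E) p p) :=
  (mdifferentiableAt_iff_coordField (mem_chart_source E p)).1 (hX.mdifferentiableAt p)

lemma coordField_extend (p : M) (v : TangentSpace 𝓘(ℝ, E) p) {x : E}
    (hx : x ∈ (extChartAt 𝓘(ℝ, E) p).target) :
    coordField p (extend E v) x = toCoord p p v := by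
  have hq : (extChartAt 𝓘(ℝ, E) p).symm x ∈ (chartAt E p).source := by
    rw [← extChartAt_source 𝓘(ℝ, E)]
    exact (extChartAt 𝓘(ℝ, E) p).map_target hx
  rw [coordField, extend_eq_ofCoord p v hq, toCoord_ofCoord hq]

lemma toCoord_mlieBracket {X Y : ∀ p : M, TangentSpace 𝓘(ℝ, E) p} (p : M) :
    toCoord p p (mlieBracket 𝓘(ℝ, E) X Y p) =
      lieBracket ℝ (coordField p X) (coordField p Y) (extChartAt 𝓘(ℝ, E) p p) := by
  have h : ∀ X : ∀ p : M, TangentSpace 𝓘(ℝ, E) p, ∀ᶠ q in 𝓝 p,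
      mfderiv 𝓘(ℝ, E) 𝓘(ℝ, E) (extChartAt 𝓘(ℝ, E) p) q (X q) =
        coordField p X (extChartAt 𝓘(ℝ, E) p q) := by
    intro X
    filter_upwards [(chartAt E p).open_source.mem_nhds (mem_chart_source E p)] with q hq
    rw [mfderiv_extChartAt_eq_toCoord hq]
    exact (coordField_extChartAt hq X).symm
  have h1 := mfderiv_extChartAt_mlieBracket (h X) (h Y)
  rw [mfderiv_extChartAt_eq_toCoord (mem_chart_source E p)] at h1
  exact h1

variable [FiniteDimensional ℝ E]

/-- Smoothness of the connection is tested on globally smooth fields, so the local frame is cut off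
by a bump function; `M` being Hausdorff makes the cut-off field smooth. -/
lemma exists_contMDiff_eventually_eq_ofCoord [T2Space M] (p : M) (v : E) :
    ∃ σ : ∀ q : M, TangentSpace 𝓘(ℝ, E) q, IsSmoothField σ ∧
      ∀ᶠ q in 𝓝 p, σ q = ofCoord p q v := by
  let ψ : SmoothBumpFunction 𝓘(ℝ, E) p := Classical.arbitrary _
  refine ⟨fun q => ψ q • ofCoord p q v, ?_, ?_⟩
  · exact ContMDiffOn.smul_section_of_tsupport (ψ := ψ) ψ.contMDiff.contMDiffOn
      (chartAt E p).open_source ψ.tsupport_subset_chartAt_source (contMDiffOn_ofCoord p v)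
  · filter_upwards [ψ.eventuallyEq_one] with q hq
    rw [hq, Pi.one_apply, one_smul]

lemma differentiableAt_coordChristoffel [T2Space M] (D : AffineConnection E M)
    (hD : D.ContMDiffCovariantDerivative ∞) (p : M) (v : E) :
    DifferentiableAt ℝ (coordChristoffel D p) (extChartAt 𝓘(ℝ, E) p p, v) := by
  have key : ∀ e : E, DifferentiableAt ℝ ((fun q => (toCoord p q).comp
      ((D (fun q => ofCoord p q e) q).comp (ofCoord p q))) ∘ (extChartAt 𝓘(ℝ, E) p).symm)
      (extChartAt 𝓘(ℝ, E) p p) := by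
    intro e
    obtain ⟨σ, hσ, hσp⟩ := exists_contMDiff_eventually_eq_ofCoord p e
    have h1 := (hD.contMDiff.contMDiff (σ := σ) hσ.contMDiffOn).contMDiffAt Filter.univ_mem
      (x := p)
    have h2 : MDifferentiableAt 𝓘(ℝ, E) 𝓘(ℝ, E →L[ℝ] E)
        (fun q => (toCoord p q).comp ((D (fun q => ofCoord p q e) q).comp (ofCoord p q))) p := by
      -- In the trivializations at `p`, the section `D σ` of the endomorphism bundle is the same
      -- composite with `σ` in place of the frame field.
      refine (((contMDiffAt_hom_bundle _).1 h1).2.mdifferentiableAt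
        (by simp)).congr_of_eventuallyEq ?_
      filter_upwards [hσp.eventually_nhds, (chartAt E p).open_source.mem_nhds
        (mem_chart_source E p)] with q hq hqs
      have h3 := D.isCovariantDerivativeOnUniv.congr_of_eventuallyEq
        (hσ.mdifferentiableAt q) (mdifferentiableAt_ofCoord hqs e)
        Filter.univ_mem hq
      rw [← h3]
      rfl
    have h4 : MDifferentiableAt 𝓘(ℝ, E) 𝓘(ℝ, E) (extChartAt 𝓘(ℝ, E) p).symm
        (extChartAt 𝓘(ℝ, E) p p) := by
      have := mdifferentiableWithinAt_extChartAt_symm (I := 𝓘(ℝ, E)) (mem_extChartAt_target p)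
      rwa [ModelWithCorners.range_eq_univ, mdifferentiableWithinAt_univ] at this
    rw [← mdifferentiableAt_iff_differentiableAt]
    exact MDifferentiableAt.comp_of_eq (I := 𝓘(ℝ, E)) (I' := 𝓘(ℝ, E)) (I'' := 𝓘(ℝ, E →L[ℝ] E))
      _ h2 h4 (extChartAt_to_inv p)
  unfold coordChristoffel christoffel
  refine DifferentiableAt.fun_sum fun i _ => ?_
  have h1 : DifferentiableAt ℝ (fun z : E × E => (Module.finBasis ℝ E).coord i z.2)
      (extChartAt 𝓘(ℝ, E) p p, v) :=
    (LinearMap.toContinuousLinearMap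
      ((Module.finBasis ℝ E).coord i)).differentiableAt.comp _ differentiableAt_snd
  have h2 := DifferentiableAt.comp (𝕜 := ℝ) ((extChartAt 𝓘(ℝ, E) p p, v) : E × E)
      (key (Module.finBasis ℝ E i)) differentiableAt_fst
  exact h1.smul h2

lemma coordChristoffel_add_smul (D : AffineConnection E M) (p : M) (z : E × E) (w : E) (t : ℝ) :
    coordChristoffel D p (z.1, z.2 + t • w) =
      coordChristoffel D p z + t • coordChristoffel D p (z.1, w) :=
  christoffel_add_smul D p _ _ _ _

/-- Needed on the whole chart target, not only at the centre, because the result is differentiated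
once more. -/
lemma coordField_covariantDerivative_extend (D : AffineConnection E M) (p : M)
    (v : TangentSpace 𝓘(ℝ, E) p) (Y : ∀ p : M, TangentSpace 𝓘(ℝ, E) p) {x : E}
    (hx : x ∈ (extChartAt 𝓘(ℝ, E) p).target) :
    coordField p (fun q => D (extend E v) q (Y q)) x =
      coordChristoffel D p (x, toCoord p p v) (coordField p Y x) := by
  have hq : (extChartAt 𝓘(ℝ, E) p).symm x ∈ (chartAt E p).source := by
    rw [← extChartAt_source 𝓘(ℝ, E)]
    exact (extChartAt 𝓘(ℝ, E) p).map_target hx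
  have hd : ∀ᶠ y in 𝓝 x, coordField p (extend E v) y = toCoord p p v := by
    filter_upwards [(isOpen_extChartAt_target p).mem_nhds hx] with y hy
    exact coordField_extend p v hy
  have hright := (extChartAt 𝓘(ℝ, E) p).right_inv hx
  have hmd : MDifferentiableAt 𝓘(ℝ, E) 𝓘(ℝ, E).tangent
      (fun q => (⟨q, extend E v q⟩ : TangentBundle 𝓘(ℝ, E) M))
      ((extChartAt 𝓘(ℝ, E) p).symm x) := by
    rw [mdifferentiableAt_iff_coordField hq, hright]
    exact (differentiableAt_const (toCoord p p v)).congr_of_eventuallyEq hd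
  have h := toCoord_covariantDerivative D hq hmd (Y ((extChartAt 𝓘(ℝ, E) p).symm x))
  have hf : fderiv ℝ (coordField p (extend E v)) x = 0 := by
    rw [Filter.EventuallyEq.fderiv_eq (f₁ := coordField p (extend E v)) hd]
    exact fderiv_const_apply _
  rw [hright, hf, extend_eq_ofCoord p v hq, toCoord_ofCoord hq] at h
  refine h.trans ?_
  rw [_root_.zero_apply, zero_add]
  rfl

/-- Near `x` the field `∇_Y U` has coordinates `K(y, w) Y(y)`. The product rule gives the first two
terms, and the Christoffel term of the outer derivative gives the third. -/
lemma toCoord_covariantDerivative_covariantDerivative_extend [T2Space M] (D : AffineConnection E M)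
    (hD : D.ContMDiffCovariantDerivative ∞) {X Y : ∀ p : M, TangentSpace 𝓘(ℝ, E) p}
    (hY : IsSmoothField Y) (p : M) (v : TangentSpace 𝓘(ℝ, E) p) {K : E × E → E →L[ℝ] E}
    {x w : E} (hKdef : K = coordChristoffel D p) (hx : x = extChartAt 𝓘(ℝ, E) p p)
    (hw : w = toCoord p p v) :
    toCoord p p (D (fun q => D (extend E v) q (Y q)) p (X p)) =
      fderiv ℝ K (x, w) (coordField p X x, 0) (coordField p Y x)
        + K (x, w) (fderiv ℝ (coordField p Y) x (coordField p X x))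
        + K (x, K (x, w) (coordField p Y x)) (coordField p X x) := by
  have hp := mem_chart_source E p
  have hK : DifferentiableAt ℝ K (x, w) := by
    rw [hKdef, hx]
    exact differentiableAt_coordChristoffel D hD p w
  have hev : coordField p (fun q => D (extend E v) q (Y q)) =ᶠ[𝓝 x]
      fun y => K (y, w) (coordField p Y y) := by
    rw [hx]
    filter_upwards [(isOpen_extChartAt_target p).mem_nhds (mem_extChartAt_target p)] with y hy
    rw [coordField_covariantDerivative_extend D p v Y hy, hKdef, hw]
  have h1 : HasFDerivAt (fun y : E => K (y, w))
      ((fderiv ℝ K (x, w)).comp ((ContinuousLinearMap.id ℝ E).prod 0)) x :=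
    HasFDerivAt.comp x hK.hasFDerivAt ((hasFDerivAt_id x).prodMk (hasFDerivAt_const w x))
  have h2 : HasFDerivAt (coordField p Y) (fderiv ℝ (coordField p Y) x) x := by
    rw [hx]
    exact (hY.differentiableAt_coordField p).hasFDerivAt
  have h3 := (h1.clm_apply h2).congr_of_eventuallyEq hev
  have hmd : MDifferentiableAt 𝓘(ℝ, E) 𝓘(ℝ, E).tangent
      (fun q => (⟨q, D (extend E v) q (Y q)⟩ : TangentBundle 𝓘(ℝ, E) M)) p := by
    rw [mdifferentiableAt_iff_coordField hp, ← hx]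
    exact h3.differentiableAt
  have h4 := toCoord_covariantDerivative D hp hmd (X p)
  have h5 := hev.eq_of_nhds
  rw [← coordChristoffel_extChartAt D hp, ← coordField_extChartAt hp X,
    ← coordField_extChartAt hp (fun q => D (extend E v) q (Y q)), ← hKdef, ← hx, h5,
    h3.fderiv] at h4
  refine h4.trans (congrArg₂ (fun a b : E => a + b) ?_ rfl)
  exact add_comm _ _

lemma toCoord_curvatureAt [T2Space M] (D : AffineConnection E M)
    (hD : D.ContMDiffCovariantDerivative ∞) {X Y : ∀ p : M, TangentSpace 𝓘(ℝ, E) p}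
    (hX : IsSmoothField X) (hY : IsSmoothField Y) (u : TangentBundle 𝓘(ℝ, E) M) :
    toCoord u.proj u.proj (curvatureAt D X Y u) =
      modelCurvature (coordChristoffel D u.proj) (coordField u.proj X) (coordField u.proj Y)
        (extChartAt 𝓘(ℝ, E) u.proj u.proj, toCoord u.proj u.proj u.2) := by
  rcases u with ⟨p, v⟩
  set K := coordChristoffel D p with hK
  set x := extChartAt 𝓘(ℝ, E) p p with hx
  set w : E := toCoord p p v with hw
  have h1 := toCoord_covariantDerivative_covariantDerivative_extend D hD (X := X) hY p v hK hx hw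
  have h2 := toCoord_covariantDerivative_covariantDerivative_extend D hD (X := Y) hX p v hK hx hw
  have h3 := coordField_covariantDerivative_extend D p v (mlieBracket 𝓘(ℝ, E) X Y)
    (mem_extChartAt_target p)
  have hp := mem_chart_source E p
  rw [coordField_extChartAt hp, coordField_extChartAt hp, toCoord_mlieBracket, ← hx, ← hw,
    ← hK] at h3
  have h4 : toCoord p p (curvatureAt D X Y (⟨p, v⟩ : TangentBundle 𝓘(ℝ, E) M)) =
      toCoord p p (D (fun q => D (extend E v) q (Y q)) p (X p))
      - toCoord p p (D (fun q => D (extend E v) q (X q)) p (Y p))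
      - toCoord p p (D (extend E v) p (mlieBracket 𝓘(ℝ, E) X Y p)) := by
    rw [← map_sub, ← map_sub]
    rfl
  have hKd : DifferentiableAt ℝ K (x, w) := differentiableAt_coordChristoffel D hD p w
  have hvert := fun b => fderiv_apply_vertical hKd
    (fun b t => coordChristoffel_add_smul D p (x, w) b t) b
  -- The fibre part of a derivative along a horizontal lift is the quadratic Christoffel term
  -- produced by the second covariant derivative.
  have hsplit : ∀ a b : E, fderiv ℝ K (x, w) (a, -b) = fderiv ℝ K (x, w) (a, 0) - K (x, b) := by
    intro a b
    rw [← hvert b, ← map_sub]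
    simp
  refine h4.trans ?_
  -- Antisymmetrizing, the terms with derivatives of `X` and `Y` cancel against `∇_{[X, Y]} U`.
  rw [h1, h2, h3]
  simp only [modelCurvature, modelHLift, lieBracket, hsplit, _root_.sub_apply, map_sub]
  abel

end

/-! ### Brackets of lifts on `TM` -/

section

section Neg

variable {F H : Type*} [NormedAddCommGroup F] [NormedSpace ℝ F] [TopologicalSpace H]
  {I : ModelWithCorners ℝ F H} {N : Type*} [TopologicalSpace N] [ChartedSpace H N]

/-- Negation commutes with differentiation whether or not the field is differentiable, so no
regularity of `V` or `W` is required. -/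
lemma lieBracketWithin_neg_left (V W : F → F) {s : Set F} {x : F}
    (hs : UniqueDiffWithinAt ℝ s x) :
    lieBracketWithin ℝ (-V) W s x = -lieBracketWithin ℝ V W s x := by
  have h : fderivWithin ℝ (-V) s x = -fderivWithin ℝ V s x := fderivWithin_neg hs
  rw [lieBracketWithin, lieBracketWithin, h]
  simp only [Pi.neg_apply, map_neg, _root_.neg_apply]
  abel

lemma mlieBracket_neg_left (V W : ∀ q : N, TangentSpace I q) (x : N) :
    mlieBracket I (fun q => -V q) W x = -mlieBracket I V W x := by
  have h : mpullbackWithin 𝓘(ℝ, F) I (extChartAt I x).symm (fun q => -V q) (Set.range I) =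
      -mpullbackWithin 𝓘(ℝ, F) I (extChartAt I x).symm V (Set.range I) := mpullbackWithin_neg
  rw [← mlieBracketWithin_univ, ← mlieBracketWithin_univ, mlieBracketWithin_apply,
    mlieBracketWithin_apply, h, Set.preimage_univ, Set.univ_inter]
  exact (congrArg _ (lieBracketWithin_neg_left _ _ (I.uniqueDiffOn _ (Set.mem_range_self _)))).trans
    (map_neg (mfderiv I 𝓘(ℝ, F) (extChartAt I x) x).inverse _)

lemma mlieBracket_neg_right (V W : ∀ q : N, TangentSpace I q) (x : N) :
    mlieBracket I V (fun q => -W q) x = -mlieBracket I V W x := by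
  rw [mlieBracket_swap_apply, mlieBracket_neg_left, mlieBracket_swap_apply (V := W), neg_neg]

end Neg

variable {E : Type*} [NormedAddCommGroup E] [NormedSpace ℝ E]
  {M : Type*} [TopologicalSpace M] [ChartedSpace E M] [IsManifold 𝓘(ℝ, E) ∞ M]

lemma mfderiv_extChartAt_tangentBundle_injective (u : TangentBundle 𝓘(ℝ, E) M) :
    Function.Injective
      (mfderiv 𝓘(ℝ, E).tangent 𝓘(ℝ, E × E) (extChartAt 𝓘(ℝ, E).tangent u) u : E × E → E × E) :=
  (isInvertible_mfderiv_extChartAt (I := 𝓘(ℝ, E).tangent) (mem_extChartAt_source u)).injective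

lemma mlieBracket_vLift_vLift {X Y : ∀ p : M, TangentSpace 𝓘(ℝ, E) p}
    (hX : IsSmoothField X) (hY : IsSmoothField Y) (u : TangentBundle 𝓘(ℝ, E) M) :
    mlieBracket 𝓘(ℝ, E).tangent (vLift X) (vLift Y) u = 0 := by
  have h := mfderiv_extChartAt_mlieBracket (mfderiv_extChartAt_vLift X u)
    (mfderiv_extChartAt_vLift Y u)
  refine mfderiv_extChartAt_tangentBundle_injective u (h.trans ?_)
  rcases u with ⟨p, v⟩
  refine (congrArg _ (extChartAt_tangentBundle_mk (mem_chart_source E p) v)).trans ?_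
  refine (lieBracket_modelVLift_modelVLift (hX.differentiableAt_coordField p)
      (hY.differentiableAt_coordField p)).trans ?_
  exact (map_zero (mfderiv 𝓘(ℝ, E).tangent 𝓘(ℝ, E × E) (extChartAt 𝓘(ℝ, E).tangent
    (⟨p, v⟩ : TangentBundle 𝓘(ℝ, E) M)) (⟨p, v⟩ : TangentBundle 𝓘(ℝ, E) M))).symm

variable [FiniteDimensional ℝ E] [T2Space M]

lemma mlieBracket_hLift_vLift (D : AffineConnection E M) (hD : D.ContMDiffCovariantDerivative ∞)
    {X Y : ∀ p : M, TangentSpace 𝓘(ℝ, E) p} (hX : IsSmoothField X) (hY : IsSmoothField Y)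
    (u : TangentBundle 𝓘(ℝ, E) M) :
    mlieBracket 𝓘(ℝ, E).tangent (hLift D X) (vLift Y) u =
      vertical u (D Y u.proj (X u.proj)) := by
  have h := mfderiv_extChartAt_mlieBracket (mfderiv_extChartAt_hLift D X u)
    (mfderiv_extChartAt_vLift Y u)
  refine mfderiv_extChartAt_tangentBundle_injective u (h.trans ?_)
  rcases u with ⟨p, v⟩
  have hp := mem_chart_source E p
  have hK := differentiableAt_coordChristoffel D hD p (toCoord p p v)
  refine Eq.trans ?_ (mfderiv_extChartAt_vertical hp v v (D Y p (X p))).symm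
  refine (congrArg _ (extChartAt_tangentBundle_mk hp v)).trans ?_
  refine (lieBracket_modelHLift_modelVLift hK
    (hX.differentiableAt_coordField p) (hY.differentiableAt_coordField p)).trans ?_
  -- The fibre derivative contributes `K(x, Y) X`, exactly the Christoffel term of `∇_X Y`.
  rw [fderiv_apply_vertical hK fun b t => coordChristoffel_add_smul D p _ b t,
    toCoord_covariantDerivative D hp (hY.mdifferentiableAt p),
    coordChristoffel_extChartAt D hp, coordField_extChartAt hp, coordField_extChartAt hp]

lemma mlieBracket_vLift_hLift (D : AffineConnection E M) (hD : D.ContMDiffCovariantDerivative ∞)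
    {X Y : ∀ p : M, TangentSpace 𝓘(ℝ, E) p} (hX : IsSmoothField X) (hY : IsSmoothField Y)
    (u : TangentBundle 𝓘(ℝ, E) M) :
    mlieBracket 𝓘(ℝ, E).tangent (vLift X) (hLift D Y) u =
      -vertical u (D X u.proj (Y u.proj)) := by
  rw [mlieBracket_swap_apply, mlieBracket_hLift_vLift D hD hY hX]

lemma mlieBracket_hLift_hLift (D : AffineConnection E M) (hD : D.ContMDiffCovariantDerivative ∞)
    {X Y : ∀ p : M, TangentSpace 𝓘(ℝ, E) p} (hX : IsSmoothField X) (hY : IsSmoothField Y)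
    (u : TangentBundle 𝓘(ℝ, E) M) :
    mlieBracket 𝓘(ℝ, E).tangent (hLift D X) (hLift D Y) u =
      horizontal D u (mlieBracket 𝓘(ℝ, E) X Y u.proj) - vertical u (curvatureAt D X Y u) := by
  have h := mfderiv_extChartAt_mlieBracket (mfderiv_extChartAt_hLift D X u)
    (mfderiv_extChartAt_hLift D Y u)
  refine mfderiv_extChartAt_tangentBundle_injective u (h.trans ?_)
  have hR := toCoord_curvatureAt D hD hX hY u
  rcases u with ⟨p, v⟩
  have hp := mem_chart_source E p
  refine Eq.trans ?_ (map_sub (mfderiv 𝓘(ℝ, E).tangent 𝓘(ℝ, E × E)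
    (extChartAt 𝓘(ℝ, E).tangent (⟨p, v⟩ : TangentBundle 𝓘(ℝ, E) M))
    (⟨p, v⟩ : TangentBundle 𝓘(ℝ, E) M)) _ _).symm
  refine Eq.trans ?_ (congrArg₂ (fun a b : E × E => a - b)
    (mfderiv_extChartAt_horizontal D hp v v (mlieBracket 𝓘(ℝ, E) X Y p))
    (mfderiv_extChartAt_vertical hp v v
      (curvatureAt D X Y (⟨p, v⟩ : TangentBundle 𝓘(ℝ, E) M)))).symm
  refine (congrArg _ (extChartAt_tangentBundle_mk hp v)).trans ?_
  refine (lieBracket_modelHLift_modelHLift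
    (differentiableAt_coordChristoffel D hD p (toCoord p p v))
    (hX.differentiableAt_coordField p) (hY.differentiableAt_coordField p)).trans ?_
  rw [toCoord_mlieBracket, coordChristoffel_extChartAt D hp]
  refine Prod.ext (sub_zero _).symm ?_
  exact congrArg (fun a : E => _ - a) hR.symm

end

/-! ### Algebraic rules for the final computation -/

section

variable {E : Type*} [NormedAddCommGroup E] [NormedSpace ℝ E]
  {M : Type*} [TopologicalSpace M] [ChartedSpace E M] [IsManifold 𝓘(ℝ, E) ∞ M]

lemma IsSmoothField.map (J : AlmostComplexStructure E M) {X : ∀ p : M, TangentSpace 𝓘(ℝ, E) p}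
    (hX : IsSmoothField X) : IsSmoothField (J.map X) :=
  ContMDiff.clm_bundle_apply (E₁ := (TangentSpace 𝓘(ℝ, E) : M → Type _))
    (E₂ := (TangentSpace 𝓘(ℝ, E) : M → Type _)) J.smooth hX

lemma AlmostComplexStructure.map_map (J : AlmostComplexStructure E M)
    (X : ∀ p : M, TangentSpace 𝓘(ℝ, E) p) : J.map (J.map X) = -X :=
  funext fun p => J.sq_eq_neg p (X p)

lemma IsSmoothField.covariantDerivative_neg (D : AffineConnection E M)
    {X : ∀ p : M, TangentSpace 𝓘(ℝ, E) p} (hX : IsSmoothField X) (p : M) :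
    D (-X) p = -D X p := by
  have h := D.isCovariantDerivativeOnUniv.smul_const (-1) (hX.mdifferentiableAt p)
  simpa using h

/-- Writing the fields as `J.map X` lets the rules for smooth fields apply to the brackets on `M`.
-/
lemma nijenhuis_eq (J : AlmostComplexStructure E M) (X Y : ∀ p : M, TangentSpace 𝓘(ℝ, E) p)
    (p : M) :
    nijenhuis 𝓘(ℝ, E) J X Y p =
      mlieBracket 𝓘(ℝ, E) X Y p + J p (mlieBracket 𝓘(ℝ, E) (J.map X) Y p)
        + J p (mlieBracket 𝓘(ℝ, E) X (J.map Y) p) - mlieBracket 𝓘(ℝ, E) (J.map X) (J.map Y) p := rfl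

variable [FiniteDimensional ℝ E]

lemma IsTorsionFree.mlieBracket_eq {D : AffineConnection E M} (h : IsTorsionFree D)
    {X Y : ∀ p : M, TangentSpace 𝓘(ℝ, E) p} (hX : IsSmoothField X) (hY : IsSmoothField Y) (p : M) :
    mlieBracket 𝓘(ℝ, E) X Y p = D Y p (X p) - D X p (Y p) := by
  have : CompleteSpace E := FiniteDimensional.complete ℝ E
  have : IsManifold 𝓘(ℝ, E) 2 M := inferInstance
  exact (D.torsion_eq_zero_iff.1 h (hX.mdifferentiableAt p) (hY.mdifferentiableAt p)).symm

section Action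

variable (D : AffineConnection E M) (J : AlmostComplexStructure E M)
  (u : TangentBundle 𝓘(ℝ, E) M) (ξ : TangentSpace 𝓘(ℝ, E) u.proj)

/-- Inside a bracket the `J_α` act on lifted fields; outside it they act on the lift of a single
vector such as a curvature value. The rules that follow cover the second case. -/
lemma hvEquiv_symm_horizontal : (hvEquiv D u).symm (horizontal D u ξ) = (ξ, 0) := by
  rw [ContinuousLinearEquiv.symm_apply_eq, hvEquiv_apply, map_zero, add_zero]

lemma hvEquiv_symm_vertical : (hvEquiv D u).symm (vertical u ξ) = (0, ξ) := by
  rw [ContinuousLinearEquiv.symm_apply_eq, hvEquiv_apply, map_zero, zero_add]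

lemma J₁_horizontal : J₁ D J u (horizontal D u ξ) = -horizontal D u (J u.proj ξ) := by
  simp [J₁, hvEquiv_symm_horizontal]

lemma J₁_vertical : J₁ D J u (vertical u ξ) = vertical u (J u.proj ξ) := by
  simp [J₁, hvEquiv_symm_vertical]

lemma J₂_horizontal : J₂ D u (horizontal D u ξ) = vertical u ξ := by
  simp [J₂, hvEquiv_symm_horizontal]

lemma J₂_vertical : J₂ D u (vertical u ξ) = -horizontal D u ξ := by
  simp [J₂, hvEquiv_symm_vertical]

lemma J₃_horizontal : J₃ D J u (horizontal D u ξ) = vertical u (J u.proj ξ) := by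
  simp [J₃, hvEquiv_symm_horizontal]

lemma J₃_vertical : J₃ D J u (vertical u ξ) = horizontal D u (J u.proj ξ) := by
  simp [J₃, hvEquiv_symm_vertical]

end Action

end

end TangentLift

end

open TangentLift in
theorem mainTheorem2 {E : Type*} [NormedAddCommGroup E] [NormedSpace ℝ E] [FiniteDimensional ℝ E]
    {M : Type*} [TopologicalSpace M] [T2Space M] [ChartedSpace E M] [IsManifold 𝓘(ℝ, E) ∞ M]
    (J : AlmostComplexStructure E M)
    (D : AffineConnection E M) (hsmooth : D.ContMDiffCovariantDerivative ∞)
    (htorsion : IsTorsionFree D)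
    (X Y : ∀ p : M, TangentSpace 𝓘(ℝ, E) p) (hX : IsSmoothField X) (hY : IsSmoothField Y)
    (u : TangentBundle 𝓘(ℝ, E) M) :
    -- the Nijenhuis tensor of `J₁`
    (nijenhuis 𝓘(ℝ, E).tangent (J₁ D J) (hLift D X) (hLift D Y) u =
        horizontal D u (nijenhuis 𝓘(ℝ, E) J X Y u.proj)
          + vertical u (curvatureAt D (J.map X) (J.map Y) u
              + J u.proj (curvatureAt D (J.map X) Y u)
              + J u.proj (curvatureAt D X (J.map Y) u)
              - curvatureAt D X Y u) ∧
      nijenhuis 𝓘(ℝ, E).tangent (J₁ D J) (hLift D X) (vLift Y) u =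
        vertical u (covDerivJ D J (J.map X) Y u.proj - covDerivJ D J X (J.map Y) u.proj) ∧
      nijenhuis 𝓘(ℝ, E).tangent (J₁ D J) (vLift X) (hLift D Y) u =
        vertical u (covDerivJ D J Y (J.map X) u.proj - covDerivJ D J (J.map Y) X u.proj) ∧
      nijenhuis 𝓘(ℝ, E).tangent (J₁ D J) (vLift X) (vLift Y) u = 0) ∧
    -- the Nijenhuis tensor of `J₂`
    (nijenhuis 𝓘(ℝ, E).tangent (J₂ D) (hLift D X) (hLift D Y) u =
        -vertical u (curvatureAt D X Y u) ∧
      -nijenhuis 𝓘(ℝ, E).tangent (J₂ D) (vLift X) (vLift Y) u =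
        -vertical u (curvatureAt D X Y u) ∧
      nijenhuis 𝓘(ℝ, E).tangent (J₂ D) (hLift D X) (vLift Y) u =
        -horizontal D u (curvatureAt D X Y u) ∧
      nijenhuis 𝓘(ℝ, E).tangent (J₂ D) (vLift X) (hLift D Y) u =
        -horizontal D u (curvatureAt D X Y u)) ∧
    -- the Nijenhuis tensor of `J₃`
    (nijenhuis 𝓘(ℝ, E).tangent (J₃ D J) (hLift D X) (hLift D Y) u =
        horizontal D u (J u.proj (covDerivJ D J X Y u.proj) - J u.proj (covDerivJ D J Y X u.proj))
          - vertical u (curvatureAt D X Y u) ∧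
      nijenhuis 𝓘(ℝ, E).tangent (J₃ D J) (hLift D X) (vLift Y) u =
        vertical u (J u.proj (covDerivJ D J X Y u.proj) + covDerivJ D J (J.map Y) X u.proj)
          - horizontal D u (J u.proj (curvatureAt D X (J.map Y) u)) ∧
      nijenhuis 𝓘(ℝ, E).tangent (J₃ D J) (vLift X) (hLift D Y) u =
        -vertical u (covDerivJ D J (J.map X) Y u.proj + J u.proj (covDerivJ D J Y X u.proj))
          - horizontal D u (J u.proj (curvatureAt D (J.map X) Y u)) ∧
      nijenhuis 𝓘(ℝ, E).tangent (J₃ D J) (vLift X) (vLift Y) u =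
        -horizontal D u (covDerivJ D J (J.map X) Y u.proj - covDerivJ D J (J.map Y) X u.proj)
          + vertical u (curvatureAt D (J.map X) (J.map Y) u)) := by
  have hJX := hX.map J
  have hJY := hY.map J
  simp only [nijenhuis_eq]
  simp only [nijenhuis, J₁_hLift, J₁_vLift, J₂_hLift, J₂_vLift, J₃_hLift, J₃_vLift,
    mlieBracket_neg_left, mlieBracket_neg_right, mlieBracket_hLift_hLift D hsmooth,
    mlieBracket_hLift_vLift D hsmooth, mlieBracket_vLift_hLift D hsmooth, mlieBracket_vLift_vLift,
    htorsion.mlieBracket_eq, covDerivJ, J.map_map, IsSmoothField.covariantDerivative_neg,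
    hX, hY, hJX, hJY, map_add, map_sub, map_neg, map_zero, neg_apply, J.sq_eq_neg,
    J₁_horizontal, J₁_vertical, J₂_horizontal, J₂_vertical, J₃_horizontal, J₃_vertical]
  -- Both sides are now signed sums of lifts of covariant derivatives and curvatures, with `J`
  -- pushed inward, so only rearrangement remains.
  refine ⟨⟨?_, ?_, ?_, ?_⟩, ⟨?_, ?_, ?_, ?_⟩, ?_, ?_, ?_, ?_⟩ <;> abel
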